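/- Let $G=(V,E)$ be a finite, simple, connected graph and let $\emptyset\neq\partial V\subseteq V$ be a set of boundary vertices, with $\mathrm{int}(V)=V\setminus\partial V$. Let $\mathcal H(E)$ be the space of real matrices $b=(b_{ij})_{i,j\in V}$ with $b_{ij}=0$ whenever $ij\notin E$, and put $\langle b,d\rangle=\sum_{i,j}b_{ij}d_{ij}$. For $u\in\mathbb R^V$ let $(Du)_{ij}=u_i-u_j$ if $ij\in E$ and $(Du)_{ij}=0$ otherwise. For $b\in\mathcal H(E)$ let $(\operatorname{div}b)_i=\sum_j(b_{ji}-b_{ij})$. Let $f:\partial V\to\mathbb R$, let $a\in\mathcal H(E)$ have entries $a_{ij}\ge 0$, let $u_f\in\mathbb R^V$ satisfy $u_f=f$ on $\partial V$, and let $\mathcal H_0=\{u\in\mathbb R^V:u=0\text{ on }\partial V\}$. Consider the problems $$(P)\quad \min_{u\in\mathcal H_0}\tfrac12\langle a,|Du+Du_f|\rangle,\qquad (D)\quad \max\{-\langle b,Du_f\rangle: b\in\mathcal H(E),\ |b|\le\tfrac12a,\ \operatorname{div}b=0\text{ on }\mathrm{int}(V)\},$$ where $|\cdot|$ and $\le$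 are taken entrywise. Call $v\in\mathbb R^V$ a voltage potential for $(f,a)$, with induced current $J\in\mathcal H(E)$, if $v=f$ on $\partial V$, $J$ is antisymmetric, $|J|\le a$, $\sum_jJ_{ij}=0$ for all $i\in\mathrm{int}(V)$, and there is a symmetric matrix $\sigma$ with entries in $[0,\infty]$ such that for all $i,j$ with $v_i\ne v_j$ one has $\sigma_{ij}<\infty$, $J_{ij}=\sigma_{ij}(v_i-v_j)$ and $|J_{ij}|=a_{ij}$, while $\sigma_{ij}=\infty$ (a perfect conductor) whenever $v_i=v_j$ and $a_{ij}\neq0$. Algorithm 1. Let $\alpha>0$ and $b^0,d^0\in\mathcal H(E)$. For $k\ge0$: (1) let $u^{k+1}$ solve $\sum_j(Du^{k+1})_{ij}=\frac12[(\operatorname{div}b^k)_i-(\operatorname{div}d^k)_i]$ for $i\in\mathrm{int}(V)$ and $u^{k+1}_i=0$ for $i\in\partial V$; (2) with $w=Du^{k+1}+Du_f+b^k$, let $d^{k+1}_{ij}=\max\{|w_{ij}|-\frac{a_{ij}}{2\alpha},0\}\frac{w_{ij}}{|w_{ij}|}-(Du_f)_{ij}$ if $w_{ij}\ne0$ and $d^{k+1}_{ij}=-(Du_f)_{ij}$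 if $w_{ij}=0$; (3) let $b^{k+1}=b^k+Du^{k+1}-d^{k+1}$. Proposition. Let $u^k,b^k,d^k$ be produced by Algorithm 1. Then there are $u\in\mathcal H_0$ and $J\in\mathcal H(E)$ with $u^k\to u$, $b^k\to\frac1{2\alpha}J$ and $d^k\to Du$, such that $u$ is a solution of $(P)$ and $J=-2b$ for a solution $b$ of $(D)$. Write $v=u+u_f$. Then: 1. $J_{ij}(v_i-v_j)\ge0$ for all $i,j$, and $|J_{ij}|=a_{ij}$ whenever $v_i\neq v_j$. 2. If $a$ is symmetric, then $v$ is a voltage potential for $(f,a)$ with induced current $\frac12(J-J^{T})$. If moreover $b^0$ and $d^0$ are antisymmetric, then $J$ itself is an induced current for $v$. 3. If the data are measured on a network with finite conductivities, that is, if $a=|J^0|$ with $J^0_{ij}=\sigma^0_{ij}(v^0_i-v^0_j)$ for some symmetric matrix $\sigma^0$ with entries in $[0,\infty)$ and some $v^0\in\mathbb R^V$ with $v^0=f$ on $\partial V$ and $\sum_jJ^0_{ij}=0$ on $\mathrm{int}(V)$, then $J=J^0$, and in particular $|J|=a$. -/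

import Mathlib

namespace Network

/-- Functions on the (ordered) edges of `G`: the `V × V` matrices that vanish off the edges
(in particular on the diagonal). -/
def EdgeSpace {V : Type*} (G : SimpleGraph V) : Submodule ℝ (V → V → ℝ) where
  carrier := {b | ∀ i j, ¬ G.Adj i j → b i j = 0}
  zero_mem' := fun _ _ _ => rfl
  add_mem' := by
    intro b c hb hc i j h
    simp [hb i j h, hc i j h]
  smul_mem' := by
    intro r b hb i j h
    simp [hb i j h]

open Classical in
/-- The gradient: `(D u)_{ij} = u_i - u_j` if `ij` is an edge, and `0` otherwise. -/
noncomputable def grad {V : Type*} (G : SimpleGraph V) (u : V → ℝ) : V → V → ℝ :=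
  fun i j => if G.Adj i j then u i - u j else 0

/-- The divergence: `(div b)_i = ∑_j (b_{ji} - b_{ij})`. -/
def divg {V : Type*} [Fintype V] (b : V → V → ℝ) : V → ℝ :=
  fun i => ∑ j, (b j i - b i j)

/-- The inner product of edge functions, `∑_{i,j} b_{ij} d_{ij}`. -/
def edgeInner {V : Type*} [Fintype V] (b d : V → V → ℝ) : ℝ :=
  ∑ i, ∑ j, b i j * d i j

/-- The functions on the vertices that vanish on the boundary `B`. -/
def vanishing {V : Type*} (B : Set V) : Set (V → ℝ) :=
  {u | ∀ i ∈ B, u i = 0}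

/-- The primal energy `½ ⟨a, |D u + D u_f|⟩`. -/
noncomputable def primalEnergy {V : Type*} [Fintype V] (G : SimpleGraph V)
    (a : V → V → ℝ) (uf u : V → ℝ) : ℝ :=
  (1 / 2) * edgeInner a (fun i j => |grad G u i j + grad G uf i j|)

/-- `u` minimizes `½ ⟨a, |D u + D u_f|⟩` over the functions vanishing on `B`. -/
def IsPrimalSolution {V : Type*} [Fintype V] (G : SimpleGraph V) (B : Set V)
    (a : V → V → ℝ) (uf u : V → ℝ) : Prop :=
  u ∈ vanishing B ∧ ∀ v ∈ vanishing B, primalEnergy G a uf u ≤ primalEnergy G a uf v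

/-- The admissible set of the dual problem: `b` is an edge function with `|b| ≤ a / 2` and
`div b = 0` at all interior vertices. -/
def dualFeasible {V : Type*} [Fintype V] (G : SimpleGraph V) (B : Set V)
    (a : V → V → ℝ) : Set (V → V → ℝ) :=
  {b | b ∈ EdgeSpace G ∧ (∀ i j, |b i j| ≤ (1 / 2) * a i j) ∧ ∀ i, i ∉ B → divg b i = 0}

/-- `b` maximizes `-⟨b, D u_f⟩` over the admissible set of the dual problem. -/
def IsDualSolution {V : Type*} [Fintype V] (G : SimpleGraph V) (B : Set V)
    (a : V → V → ℝ) (uf : V → ℝ) (b : V → V → ℝ) : Prop :=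
  b ∈ dualFeasible G B a ∧
    ∀ c ∈ dualFeasible G B a, -edgeInner c (grad G uf) ≤ -edgeInner b (grad G uf)

/-- `σ` is a (possibly infinite) conductivity, `v` a voltage and `J` a current on the network
with data `(f, a)`. An edge with `σ = ∞` is a perfect conductor: its ends have the same voltage,
and it carries a current of magnitude at most `a`. -/
structure IsInducedCurrent {V : Type*} [Fintype V] (G : SimpleGraph V) (B : Set V)
    (f : B → ℝ) (a : V → V → ℝ) (v : V → ℝ) (σ : V → V → ENNReal) (J : V → V → ℝ) : Prop where
  boundary : ∀ i : B, v i = f i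
  symm : ∀ i j, σ i j = σ j i
  finite : ∀ i j, v i ≠ v j → σ i j ≠ ⊤
  ohm : ∀ i j, v i ≠ v j → J i j = (σ i j).toReal * (v i - v j)
  magnitude : ∀ i j, v i ≠ v j → |J i j| = a i j
  perfect : ∀ i j, v i = v j → a i j ≠ 0 → σ i j = ⊤
  mem_edge : J ∈ EdgeSpace G
  antisymm : ∀ i j, J i j = -J j i
  magnitude_le : ∀ i j, |J i j| ≤ a i j
  kirchhoff : ∀ i, i ∉ B → ∑ j, J i j = 0

/-- `v` is a voltage potential for the data `(f, a)`. -/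
def IsVoltagePotential {V : Type*} [Fintype V] (G : SimpleGraph V) (B : Set V)
    (f : B → ℝ) (a : V → V → ℝ) (v : V → ℝ) : Prop :=
  ∃ (σ : V → V → ENNReal) (J : V → V → ℝ), IsInducedCurrent G B f a v σ J

/-- `(f, a)` is measured on a network with finite conductivities `σ`: the voltage `f` imposed on
`B` induces the current `J`, and `a = |J|`. -/
structure IsMeasuredCurrent {V : Type*} [Fintype V] (B : Set V)
    (f : B → ℝ) (a : V → V → ℝ) (v : V → ℝ) (σ : V → V → ℝ) (J : V → V → ℝ) : Prop where
  boundary : ∀ i : B, v i = f i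
  symm : ∀ i j, σ i j = σ j i
  nonneg : ∀ i j, 0 ≤ σ i j
  ohm : ∀ i j, J i j = σ i j * (v i - v j)
  magnitude : ∀ i j, |J i j| = a i j
  kirchhoff : ∀ i, i ∉ B → ∑ j, J i j = 0

/-- Soft thresholding of `w` at the level `t`. -/
noncomputable def shrink (t w : ℝ) : ℝ :=
  if w ≠ 0 then max (|w| - t) 0 * (w / |w|) else 0

/-- `(u^k)`, `(b^k)`, `(d^k)` are produced by the alternating split Bregman algorithm for the
Dirichlet problem, with parameter `α`. The algorithm does not produce `u^0`. -/
structure IsSplitBregman {V : Type*} [Fintype V] (G : SimpleGraph V) (B : Set V)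
    (a : V → V → ℝ) (uf : V → ℝ) (α : ℝ)
    (u : ℕ → V → ℝ) (b d : ℕ → V → V → ℝ) : Prop where
  b_init : b 0 ∈ EdgeSpace G
  d_init : d 0 ∈ EdgeSpace G
  u_interior : ∀ k i, i ∉ B →
    ∑ j, grad G (u (k + 1)) i j = (1 / 2) * (divg (b k) i - divg (d k) i)
  u_boundary : ∀ k, ∀ i ∈ B, u (k + 1) i = 0
  d_step : ∀ k i j, d (k + 1) i j =
    shrink (a i j / (2 * α)) (grad G (u (k + 1)) i j + grad G uf i j + b k i j) - grad G uf i j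
  b_step : ∀ k i j, b (k + 1) i j = b k i j + grad G (u (k + 1)) i j - d (k + 1) i j

end Network

/-! The optimality conditions for (P) and (D) combine into one system, `IsSaddle`: `u` vanishes on
`B`, `J` has zero divergence at interior vertices, and `J i j` is a subgradient of `a i j * |·|` at
the voltage drop of `u + uf`. Summation by parts makes feasible currents orthogonal to gradients of
functions in `vanishing B`, so every saddle point solves both problems. Existence comes from
minimizing a smoothed energy and letting the smoothing tend to zero.

The algorithm keeps `b` a subgradient at `d + D uf`, for the weights `a / (2α)`. Monotonicity of
subgradients then makes the squared distance of `(b, d)` to any saddle point `(c, D w)` decrease by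
at least a sum of squared increments (`dist_add_defect_le`). The iterates are therefore bounded and
the increments tend to zero, so some cluster point is a saddle point. The distance to that
particular point is monotone and tends to zero along a subsequence, so the whole sequence converges;
connectedness recovers `u` from its gradient.

The physical claims are read off the subgradient relation. It fixes the current wherever the voltage
drops. Finite conductivities force a drop wherever `a` is nonzero, which determines `J` completely.
-/

namespace Network

open Filter Topology

/-! ### Subgradients of a weighted absolute value and soft thresholding. -/

/-- `b` is a subgradient at `x` of the function `t * |·|`. -/
def IsAbsSubgradient (t b x : ℝ) : Prop :=
  |b| ≤ t ∧ b * x = t * |x|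

theorem IsAbsSubgradient.monotone {t b x c y : ℝ} (h : IsAbsSubgradient t b x)
    (h' : IsAbsSubgradient t c y) : 0 ≤ (b - c) * (x - y) := by
  have h1 : b * y ≤ t * |y| :=
    (le_abs_self _).trans (by rw [abs_mul]; gcongr; exact h.1)
  have h2 : c * x ≤ t * |x| :=
    (le_abs_self _).trans (by rw [abs_mul]; gcongr; exact h'.1)
  nlinarith [h.2, h'.2]

theorem IsAbsSubgradient.mul_nonneg {t b x : ℝ} (h : IsAbsSubgradient t b x) : 0 ≤ b * x := by
  rw [h.2]
  exact _root_.mul_nonneg ((abs_nonneg b).trans h.1) (abs_nonneg x)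

theorem IsAbsSubgradient.abs_eq {t b x : ℝ} (h : IsAbsSubgradient t b x) (hx : x ≠ 0) :
    |b| = t := by
  have h1 : |b| * |x| = t * |x| := by
    rw [← abs_mul, h.2, abs_of_nonneg]
    exact _root_.mul_nonneg ((abs_nonneg b).trans h.1) (abs_nonneg x)
  exact mul_right_cancel₀ (abs_ne_zero.2 hx) h1

theorem IsAbsSubgradient.smul {t b x : ℝ} (h : IsAbsSubgradient t b x) {r : ℝ} (hr : 0 ≤ r) :
    IsAbsSubgradient (r * t) (r * b) x := by
  refine ⟨?_, by rw [mul_assoc, h.2, mul_assoc]⟩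
  rw [abs_mul, abs_of_nonneg hr]
  exact mul_le_mul_of_nonneg_left h.1 hr

/-- Two subgradients at the same point of smoothness agree. -/
theorem IsAbsSubgradient.unique {t b c x : ℝ} (h : IsAbsSubgradient t b x)
    (h' : IsAbsSubgradient t c x) (hx : x ≠ 0) : b = c :=
  mul_right_cancel₀ hx (h.2.trans h'.2.symm)

theorem IsAbsSubgradient.neg {t b x : ℝ} (h : IsAbsSubgradient t b x) :
    IsAbsSubgradient t (-b) (-x) := by
  refine ⟨by simpa using h.1, by simpa using h.2⟩

theorem IsAbsSubgradient.of_tendsto {ι : Type*} {l : Filter ι} [l.NeBot] {t : ℝ} {b x : ι → ℝ}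
    {b' x' : ℝ} (h : ∀ᶠ k in l, IsAbsSubgradient t (b k) (x k)) (hb : Tendsto b l (𝓝 b'))
    (hx : Tendsto x l (𝓝 x')) : IsAbsSubgradient t b' x' := by
  refine ⟨le_of_tendsto hb.abs (h.mono fun _ h => h.1), ?_⟩
  refine tendsto_nhds_unique (hb.mul hx) ?_
  exact (hx.abs.const_mul t).congr' (h.mono fun _ h => h.2.symm)

/-- The residual of soft thresholding is a subgradient of `t * |·|` at the thresholded point. -/
theorem isAbsSubgradient_shrink {t : ℝ} (ht : 0 ≤ t) (w : ℝ) :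
    IsAbsSubgradient t (w - shrink t w) (shrink t w) := by
  unfold shrink
  rcases lt_trichotomy w 0 with hw | rfl | hw
  · rw [if_pos hw.ne, abs_of_neg hw, div_neg, div_self hw.ne]
    rcases le_total (-w - t) 0 with h | h
    · rw [max_eq_right h]
      refine ⟨?_, by simp⟩
      rw [abs_le]; constructor <;> linarith
    · rw [max_eq_left h]
      refine ⟨?_, ?_⟩
      · rw [abs_le]; constructor <;> linarith
      · rw [abs_of_nonpos (by linarith)]; ring
  · simpa [IsAbsSubgradient] using ht
  · rw [if_pos hw.ne', abs_of_pos hw, div_self hw.ne']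
    rcases le_total (w - t) 0 with h | h
    · rw [max_eq_right h]
      refine ⟨?_, by simp⟩
      rw [abs_le]; constructor <;> linarith
    · rw [max_eq_left h]
      refine ⟨?_, ?_⟩
      · rw [abs_le]; constructor <;> linarith
      · rw [abs_of_nonneg (by linarith)]; ring

theorem shrink_neg (t w : ℝ) : shrink t (-w) = -shrink t w := by
  unfold shrink
  by_cases hw : w = 0
  · simp [hw]
  · rw [if_pos hw, if_pos (neg_ne_zero.2 hw), abs_neg]
    ring

/-! ### Discrete gradient and divergence on a graph. -/

section Graph

variable {V : Type*} {G : SimpleGraph V} {B : Set V}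

theorem grad_of_adj {i j : V} (h : G.Adj i j) (u : V → ℝ) : grad G u i j = u i - u j := by
  simp [grad, h]

theorem grad_mem_edgeSpace (u : V → ℝ) : grad G u ∈ EdgeSpace G := by
  intro i j h
  simp [grad, h]

theorem grad_add (u v : V → ℝ) (i j : V) :
    grad G (u + v) i j = grad G u i j + grad G v i j := by
  unfold grad
  split_ifs
  · simp only [Pi.add_apply]; ring
  · simp

theorem grad_sub (u v : V → ℝ) (i j : V) :
    grad G (u - v) i j = grad G u i j - grad G v i j := by
  unfold grad
  split_ifs
  · simp only [Pi.sub_apply]; ring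
  · simp

theorem grad_antisymm (u : V → ℝ) (i j : V) : grad G u i j = -grad G u j i := by
  by_cases h : G.Adj i j
  · rw [grad_of_adj h, grad_of_adj h.symm, neg_sub]
  · rw [grad_mem_edgeSpace u i j h, grad_mem_edgeSpace u j i fun h' => h h'.symm, neg_zero]

theorem EdgeSpace.mul_grad {c : V → V → ℝ} (hc : c ∈ EdgeSpace G) (u : V → ℝ) (i j : V) :
    c i j * grad G u i j = c i j * (u i - u j) := by
  by_cases h : G.Adj i j
  · rw [grad_of_adj h]
  · rw [hc i j h, zero_mul, zero_mul]

theorem EdgeSpace.of_abs_le {a c : V → V → ℝ} (ha : a ∈ EdgeSpace G)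
    (h : ∀ i j, |c i j| ≤ a i j) : c ∈ EdgeSpace G := by
  intro i j hij
  have := h i j
  rw [ha i j hij] at this
  exact abs_nonpos_iff.1 this

theorem continuous_grad : Continuous (grad G) := by
  refine continuous_pi fun i => continuous_pi fun j => ?_
  by_cases h : G.Adj i j
  · simp only [grad_of_adj h]; fun_prop
  · simpa only [grad, h, if_false] using continuous_const

/-- On a connected graph, functions vanishing on a nonempty boundary converge as soon as their
gradients do. -/
theorem exists_tendsto_of_tendsto_grad (hG : G.Connected) (hB : B.Nonempty) {ι : Type*}
    {l : Filter ι} [l.NeBot] {u : ι → V → ℝ} {D : V → V → ℝ}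
    (hu : ∀ᶠ k in l, u k ∈ vanishing B) (hD : Tendsto (fun k => grad G (u k)) l (𝓝 D)) :
    ∃ u' ∈ vanishing B, Tendsto u l (𝓝 u') ∧ grad G u' = D := by
  obtain ⟨z, hz⟩ := hB
  have key : ∀ i, ∃ x, Tendsto (fun k => u k i) l (𝓝 x) := by
    intro i
    obtain ⟨p⟩ := hG.preconnected i z
    -- The value at `i` is the telescoping sum of gradient entries along a walk from `i` to the
    -- boundary vertex `z`, where the value is zero.
    induction p with
    | nil => exact ⟨0, tendsto_const_nhds.congr' (hu.mono fun k hk => (hk _ hz).symm)⟩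
    | @cons i j w h p ih =>
      obtain ⟨x, hx⟩ := ih hz
      refine ⟨D i j + x, ?_⟩
      have h1 := ((tendsto_pi_nhds.1 (tendsto_pi_nhds.1 hD i) j)).add hx
      refine h1.congr fun k => ?_
      rw [grad_of_adj h]; ring
  choose u' hu' using key
  have ht : Tendsto u l (𝓝 u') := tendsto_pi_nhds.2 hu'
  refine ⟨u', fun i hi => ?_, ht, ?_⟩
  · exact tendsto_nhds_unique (hu' i)
      (tendsto_const_nhds.congr' (hu.mono fun k hk => (hk i hi).symm))
  · exact tendsto_nhds_unique ((continuous_grad.tendsto u').comp ht) hD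

/-- The voltages with boundary values `uf` and values in `[-M, M]`. -/
def boundedVoltages (B : Set V) (uf : V → ℝ) (M : ℝ) : Set (V → ℝ) :=
  {v | ∀ i ∈ B, v i = uf i} ∩ Set.Icc (fun _ => -M) (fun _ => M)

theorem isCompact_boundedVoltages (B : Set V) (uf : V → ℝ) (M : ℝ) :
    IsCompact (boundedVoltages B uf M) := by
  refine isCompact_Icc.inter_left ?_
  simp only [Set.ofPred_forall]
  exact isClosed_iInter fun i => isClosed_iInter fun _ =>
    isClosed_eq (continuous_apply i) continuous_const

variable [Fintype V]

theorem continuous_divg (i : V) : Continuous fun b : V → V → ℝ => divg b i := by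
  unfold divg
  fun_prop

theorem edgeInner_add_right (b c d : V → V → ℝ) :
    edgeInner b (fun i j => c i j + d i j) = edgeInner b c + edgeInner b d := by
  simp only [edgeInner, mul_add, Finset.sum_add_distrib]

theorem edgeInner_mono {b c d e : V → V → ℝ} (h : ∀ i j, b i j * c i j ≤ d i j * e i j) :
    edgeInner b c ≤ edgeInner d e :=
  Finset.sum_le_sum fun i _ => Finset.sum_le_sum fun j _ => h i j

theorem edgeInner_congr {b c d e : V → V → ℝ} (h : ∀ i j, b i j * c i j = d i j * e i j) :
    edgeInner b c = edgeInner d e :=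
  Finset.sum_congr rfl fun i _ => Finset.sum_congr rfl fun j _ => h i j

theorem edgeInner_smul_left (r : ℝ) (b c : V → V → ℝ) :
    edgeInner (r • b) c = r * edgeInner b c := by
  simp only [edgeInner, Pi.smul_apply, smul_eq_mul, Finset.mul_sum, mul_assoc]

theorem divg_smul (r : ℝ) (b : V → V → ℝ) (i : V) : divg (r • b) i = r * divg b i := by
  simp only [divg, Pi.smul_apply, smul_eq_mul, Finset.mul_sum, mul_sub]

/-- Summation by parts. -/
theorem edgeInner_grad {c : V → V → ℝ} (hc : c ∈ EdgeSpace G) (φ : V → ℝ) :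
    edgeInner c (grad G φ) = -∑ i, φ i * divg c i := by
  unfold edgeInner divg
  simp only [EdgeSpace.mul_grad hc, mul_sub, Finset.mul_sum, Finset.sum_sub_distrib]
  rw [Finset.sum_comm (f := fun i j => φ i * c j i)]
  simp only [mul_comm (φ _)]
  ring

/-- After summation by parts each vertex contributes zero: `φ` vanishes on `B` and the divergence
vanishes off `B`. -/
theorem edgeInner_grad_eq_zero {c : V → V → ℝ} (hc : c ∈ EdgeSpace G)
    (hdiv : ∀ i, i ∉ B → divg c i = 0) {φ : V → ℝ} (hφ : φ ∈ vanishing B) :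
    edgeInner c (grad G φ) = 0 := by
  rw [edgeInner_grad hc, neg_eq_zero]
  refine Finset.sum_eq_zero fun i _ => ?_
  by_cases hi : i ∈ B
  · rw [hφ i hi, zero_mul]
  · rw [hdiv i hi, mul_zero]

theorem divg_grad (u : V → ℝ) (i : V) : divg (grad G u) i = -2 * ∑ j, grad G u i j := by
  unfold divg
  rw [Finset.mul_sum]
  refine Finset.sum_congr rfl fun j _ => ?_
  rw [grad_antisymm u j i]; ring

/-! ### Saddle points and duality. -/

/-- The optimality conditions of the primal-dual pair, for the data `t` on the edges. -/
structure IsSaddle (G : SimpleGraph V) (B : Set V) (t : V → V → ℝ) (uf u : V → ℝ)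
    (b : V → V → ℝ) : Prop where
  vanish : u ∈ vanishing B
  subgradient : ∀ i j, IsAbsSubgradient (t i j) (b i j) (grad G u i j + grad G uf i j)
  divg_eq_zero : ∀ i, i ∉ B → divg b i = 0

theorem IsSaddle.smul {t b : V → V → ℝ} {uf u : V → ℝ} (h : IsSaddle G B t uf u b) {r : ℝ}
    (hr : 0 ≤ r) : IsSaddle G B (r • t) uf u (r • b) where
  vanish := h.vanish
  subgradient i j := (h.subgradient i j).smul hr
  divg_eq_zero i hi := by rw [divg_smul, h.divg_eq_zero i hi, mul_zero]

/-- A calibration argument: pairing with `J` bounds the energy of every competitor from below, does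
not depend on the competitor, and equals the energy at `u`. -/
theorem IsSaddle.isPrimalSolution {a J : V → V → ℝ} {uf u : V → ℝ} (h : IsSaddle G B a uf u J)
    (ha : a ∈ EdgeSpace G) : IsPrimalSolution G B a uf u := by
  have hJ : J ∈ EdgeSpace G := EdgeSpace.of_abs_le ha fun i j => (h.subgradient i j).1
  refine ⟨h.vanish, fun w hw => ?_⟩
  unfold primalEnergy
  refine mul_le_mul_of_nonneg_left ?_ (by norm_num)
  calc edgeInner a (fun i j => |grad G u i j + grad G uf i j|)
      = edgeInner J (fun i j => grad G u i j + grad G uf i j) :=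
        edgeInner_congr fun i j => (h.subgradient i j).2.symm
    _ = edgeInner J (fun i j => grad G w i j + grad G uf i j) := by
        rw [edgeInner_add_right, edgeInner_add_right,
          edgeInner_grad_eq_zero hJ h.divg_eq_zero h.vanish,
          edgeInner_grad_eq_zero hJ h.divg_eq_zero hw]
    _ ≤ edgeInner a (fun i j => |grad G w i j + grad G uf i j|) :=
        edgeInner_mono fun i j => (le_abs_self _).trans
          (by rw [abs_mul]; gcongr; exact (h.subgradient i j).1)

theorem IsSaddle.isDualSolution {a J : V → V → ℝ} {uf u : V → ℝ} (h : IsSaddle G B a uf u J)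
    (ha : a ∈ EdgeSpace G) : IsDualSolution G B a uf ((-(1 / 2) : ℝ) • J) := by
  have hJ : J ∈ EdgeSpace G := EdgeSpace.of_abs_le ha fun i j => (h.subgradient i j).1
  refine ⟨⟨(EdgeSpace G).smul_mem _ hJ, fun i j => ?_, fun i hi => ?_⟩, fun c hc => ?_⟩
  · rw [Pi.smul_apply, Pi.smul_apply, smul_eq_mul, abs_mul, abs_neg,
      abs_of_nonneg (by norm_num : (0 : ℝ) ≤ 1 / 2)]
    exact mul_le_mul_of_nonneg_left (h.subgradient i j).1 (by norm_num)
  · rw [divg_smul, h.divg_eq_zero i hi, mul_zero]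
  · obtain ⟨hcE, hca, hcd⟩ := hc
    have h1 : edgeInner c (grad G uf) =
        edgeInner c (fun i j => grad G u i j + grad G uf i j) := by
      rw [edgeInner_add_right, edgeInner_grad_eq_zero hcE hcd h.vanish, zero_add]
    have h2 : edgeInner J (grad G uf) =
        edgeInner J (fun i j => grad G u i j + grad G uf i j) := by
      rw [edgeInner_add_right, edgeInner_grad_eq_zero hJ h.divg_eq_zero h.vanish, zero_add]
    -- Replacing `D uf` by `D u + D uf` on both sides costs nothing by orthogonality and reduces
    -- optimality to an entrywise bound.
    rw [edgeInner_smul_left, h1, h2, neg_mul, neg_neg, ← neg_one_mul, ← edgeInner_smul_left,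
      ← edgeInner_smul_left]
    refine edgeInner_mono fun i j => ?_
    simp only [Pi.smul_apply, smul_eq_mul]
    rw [mul_assoc (1 / 2), (h.subgradient i j).2, ← mul_assoc]
    refine (le_abs_self _).trans ?_
    rw [abs_mul, abs_mul, abs_neg, abs_one, one_mul]
    gcongr
    exact hca i j

/-- A dual solution is a subgradient at the gradient of every potential that belongs to a saddle
point. -/
theorem IsSaddle.subgradient_of_isSaddle {a J J' : V → V → ℝ} {uf u u' : V → ℝ}
    (ha : a ∈ EdgeSpace G) (h : IsSaddle G B a uf u J) (h' : IsSaddle G B a uf u' J') (i j : V) :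
    IsAbsSubgradient (a i j) (J i j) (grad G u' i j + grad G uf i j) := by
  have hJ : J ∈ EdgeSpace G := EdgeSpace.of_abs_le ha fun i j => (h.subgradient i j).1
  refine ⟨(h.subgradient i j).1, ?_⟩
  have hle : ∀ i j, J i j * (grad G u' i j + grad G uf i j) ≤
      a i j * |grad G u' i j + grad G uf i j| := fun i j =>
    (le_abs_self _).trans (by rw [abs_mul]; gcongr; exact (h.subgradient i j).1)
  have hsum : edgeInner a (fun i j => |grad G u' i j + grad G uf i j|) ≤
      edgeInner J (fun i j => grad G u' i j + grad G uf i j) := by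
    have h1 := (h'.isPrimalSolution ha).2 u h.vanish
    unfold primalEnergy at h1
    have h2 : edgeInner a (fun i j => |grad G u i j + grad G uf i j|) =
        edgeInner J (fun i j => grad G u' i j + grad G uf i j) := by
      rw [edgeInner_congr fun i j => (h.subgradient i j).2.symm,
        edgeInner_add_right, edgeInner_add_right,
        edgeInner_grad_eq_zero hJ h.divg_eq_zero h.vanish,
        edgeInner_grad_eq_zero hJ h.divg_eq_zero h'.vanish]
    linarith
  -- An entrywise inequality whose total sums agree is an equality in every entry.
  have heq := le_antisymm (edgeInner_mono hle) hsum
  unfold edgeInner at heq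
  have h3 := (Finset.sum_eq_sum_iff_of_le
    (fun i _ => Finset.sum_le_sum fun j _ => hle i j)).1 heq i (Finset.mem_univ _)
  exact (Finset.sum_eq_sum_iff_of_le (fun j _ => hle i j)).1 h3 j (Finset.mem_univ _)

/-! ### Existence of saddle points by smoothing. -/

/-- The regularization `∑ a_{ij} √((v_i - v_j)² + ε²)` of the energy. -/
noncomputable def smoothEnergy (a : V → V → ℝ) (ε : ℝ) (v : V → ℝ) : ℝ :=
  ∑ i, ∑ j, a i j * √((v i - v j) ^ 2 + ε ^ 2)

theorem abs_clamp_sub_clamp_le (M x y : ℝ) :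
    |max (-M) (min M x) - max (-M) (min M y)| ≤ |x - y| := by
  refine (abs_max_sub_max_le_max _ _ _ _).trans ?_
  rw [sub_self, abs_zero, max_eq_right (abs_nonneg _)]
  refine (abs_min_sub_min_le_max _ _ _ _).trans ?_
  rw [sub_self, abs_zero, max_eq_right (abs_nonneg _)]

/-- The regularized energy has a minimizer among the voltages with given boundary values, and it
may be chosen within given bounds, because truncation does not increase the energy. -/
theorem exists_isMin_smoothEnergy {a : V → V → ℝ} (ha0 : ∀ i j, 0 ≤ a i j) {uf : V → ℝ} {M : ℝ}
    (hM : ∀ i, |uf i| ≤ M) (ε : ℝ) :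
    ∃ v ∈ boundedVoltages B uf M, ∀ w : V → ℝ, (∀ i ∈ B, w i = uf i) →
      smoothEnergy a ε v ≤ smoothEnergy a ε w := by
  have hcont : Continuous (smoothEnergy a ε) := by unfold smoothEnergy; fun_prop
  obtain ⟨v, hv, hmin⟩ := (isCompact_boundedVoltages B uf M).exists_isMinOn
    ⟨uf, fun _ _ => rfl, fun i => (abs_le.1 (hM i)).1, fun i => (abs_le.1 (hM i)).2⟩
    hcont.continuousOn
  refine ⟨v, hv, fun w hw => ?_⟩
  have hmem : (fun i => max (-M) (min M (w i))) ∈ boundedVoltages B uf M := by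
    refine ⟨fun i hi => ?_, fun i => le_max_left _ _, fun i => max_le ?_ (min_le_left _ _)⟩
    · show max (-M) (min M (w i)) = uf i
      rw [hw i hi, min_eq_right (abs_le.1 (hM i)).2, max_eq_right (abs_le.1 (hM i)).1]
    · have := (abs_nonneg _).trans (hM i)
      show -M ≤ M
      linarith
  refine (hmin hmem).trans ?_
  refine Finset.sum_le_sum fun i _ => Finset.sum_le_sum fun j _ => ?_
  refine mul_le_mul_of_nonneg_left (Real.sqrt_le_sqrt ?_) (ha0 i j)
  have := sq_le_sq.2 (abs_clamp_sub_clamp_le M (w i) (w j))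
  linarith

/-- The coefficient of `φ i - φ j` is the current of the approximate saddle point, so stationarity
becomes a statement about its divergence. -/
theorem hasDerivAt_smoothEnergy (a : V → V → ℝ) {ε : ℝ} (hε : 0 < ε) (v φ : V → ℝ) :
    HasDerivAt (fun s : ℝ => smoothEnergy a ε (v + s • φ))
      (∑ i, ∑ j, a i j * ((v i - v j) / √((v i - v j) ^ 2 + ε ^ 2)) * (φ i - φ j)) 0 := by
  unfold smoothEnergy
  refine HasDerivAt.fun_sum fun i _ => HasDerivAt.fun_sum fun j _ => ?_
  have hlin : HasDerivAt (fun s : ℝ => (v + s • φ) i - (v + s • φ) j) (φ i - φ j) 0 := by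
    have h := ((hasDerivAt_id (0 : ℝ)).mul_const (φ i - φ j)).const_add (v i - v j)
    rw [one_mul] at h
    refine h.congr_of_eventuallyEq (Eventually.of_forall fun s => ?_)
    simp only [Pi.add_apply, Pi.smul_apply, smul_eq_mul, id]
    ring
  have hpos : (v i - v j) ^ 2 + ε ^ 2 ≠ 0 := by positivity
  have h := (((hlin.pow 2).add_const (ε ^ 2)).sqrt (by simpa using hpos)).const_mul (a i j)
  refine h.congr_deriv ?_
  have : √((v i - v j) ^ 2 + ε ^ 2) ≠ 0 := by positivity
  simp only [Pi.pow_apply, zero_smul, add_zero]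
  field_simp
  simp only [Nat.add_one_sub_one, pow_one, Nat.cast_ofNat]
  ring

/-- Approximate saddle points: currents without sources that are almost aligned with the voltage
drops. -/
theorem exists_approx_saddle {a : V → V → ℝ} (ha : a ∈ EdgeSpace G) (ha0 : ∀ i j, 0 ≤ a i j)
    {uf : V → ℝ} {M : ℝ} (hM : ∀ i, |uf i| ≤ M) {ε : ℝ} (hε : 0 < ε) :
    ∃ v ∈ boundedVoltages B uf M, ∃ J ∈ Set.Icc (-a) a,
      (∀ i j, a i j * (|v i - v j| - ε) ≤ J i j * (v i - v j)) ∧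
      ∀ i, i ∉ B → divg J i = 0 := by
  obtain ⟨v, hv, hmin⟩ := exists_isMin_smoothEnergy (B := B) ha0 hM ε
  have hs : ∀ x : ℝ, 0 < √(x ^ 2 + ε ^ 2) := fun x => by positivity
  have hxs : ∀ x : ℝ, |x| ≤ √(x ^ 2 + ε ^ 2) := fun x =>
    Real.abs_le_sqrt (by nlinarith [sq_nonneg ε])
  have hsx : ∀ x : ℝ, √(x ^ 2 + ε ^ 2) ≤ |x| + ε := fun x =>
    Real.sqrt_le_iff.2 ⟨by positivity, by nlinarith [sq_abs x, abs_nonneg x]⟩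
  set J : V → V → ℝ := fun i j => a i j * ((v i - v j) / √((v i - v j) ^ 2 + ε ^ 2)) with hJ
  have hJa : ∀ i j, |J i j| ≤ a i j := by
    intro i j
    simp only [hJ]
    rw [abs_mul, abs_of_nonneg (ha0 i j), abs_div, abs_of_pos (hs _)]
    exact mul_le_of_le_one_right (ha0 i j) ((div_le_one (hs _)).2 (hxs _))
  have hJE : J ∈ EdgeSpace G := EdgeSpace.of_abs_le ha hJa
  refine ⟨v, hv, J, ⟨fun i j => (abs_le.1 (hJa i j)).1, fun i j => (abs_le.1 (hJa i j)).2⟩,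
    fun i j => ?_, fun i hi => ?_⟩
  · simp only [hJ]
    rw [mul_assoc]
    refine mul_le_mul_of_nonneg_left ?_ (ha0 i j)
    rw [div_mul_eq_mul_div, le_div_iff₀ (hs _)]
    rcases le_total (|v i - v j| - ε) 0 with h | h
    · exact (mul_nonpos_of_nonpos_of_nonneg h (hs _).le).trans (mul_self_nonneg _)
    -- The product `(|x| - ε) * (|x| + ε)` is `x ^ 2 - ε ^ 2`, hence at most `x ^ 2`.
    · calc _ ≤ (|v i - v j| - ε) * (|v i - v j| + ε) := mul_le_mul_of_nonneg_left (hsx _) h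
        _ ≤ _ := by nlinarith [abs_mul_abs_self (v i - v j)]
  · classical
    -- Varying the value at one interior vertex preserves the boundary values and isolates the
    -- divergence there.
    set φ : V → ℝ := Pi.single i 1 with hφ
    have hloc : IsLocalMin (fun s : ℝ => smoothEnergy a ε (v + s • φ)) 0 := by
      refine Eventually.of_forall fun s => ?_
      simp only [zero_smul, add_zero]
      refine hmin _ fun j hj => ?_
      have : j ≠ i := fun h => hi (h ▸ hj)
      simp [hφ, this, hv.1 j hj]
    have h0 := hloc.hasDerivAt_eq_zero (hasDerivAt_smoothEnergy a hε v φ)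
    have h1 : edgeInner J (grad G φ) = 0 := by
      rw [← h0]
      exact Finset.sum_congr rfl fun i _ => Finset.sum_congr rfl fun j _ =>
        EdgeSpace.mul_grad hJE φ i j
    rw [edgeInner_grad hJE, neg_eq_zero] at h1
    simpa [hφ, Pi.single_apply] using h1

/-- Voltages and currents of the approximate saddle points lie in compact sets independent of the
smoothing, so a limit exists as `ε = 1 / (n + 1)` tends to zero. -/
theorem exists_isSaddle {a : V → V → ℝ} (ha : a ∈ EdgeSpace G) (ha0 : ∀ i j, 0 ≤ a i j)
    (uf : V → ℝ) : ∃ u J, IsSaddle G B a uf u J := by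
  obtain ⟨M, hM⟩ : ∃ M, ∀ i, |uf i| ≤ M := by
    obtain ⟨M, hM⟩ := (Set.finite_range fun i => |uf i|).bddAbove
    exact ⟨M, fun i => hM ⟨i, rfl⟩⟩
  have hpos : ∀ n : ℕ, (0 : ℝ) < 1 / ((n : ℝ) + 1) := fun n => Nat.one_div_pos_of_nat
  choose v hv J hJ happ hdiv using fun n : ℕ =>
    exists_approx_saddle (B := B) ha ha0 hM (hpos n)
  obtain ⟨⟨v', J'⟩, ⟨hv', hJ'⟩, ψ, hψ, hlim⟩ :=
    ((isCompact_boundedVoltages B uf M).prod (isCompact_Icc (a := -a) (b := a))).tendsto_subseq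
      (x := fun n => (v n, J n)) fun n => ⟨hv n, hJ n⟩
  have hvl : Tendsto (fun n => v (ψ n)) atTop (𝓝 v') := (continuous_fst.tendsto _).comp hlim
  have hJl : Tendsto (fun n => J (ψ n)) atTop (𝓝 J') := (continuous_snd.tendsto _).comp hlim
  have hvi : ∀ i, Tendsto (fun n => v (ψ n) i) atTop (𝓝 (v' i)) := tendsto_pi_nhds.1 hvl
  have hJij : ∀ i j, Tendsto (fun n => J (ψ n) i j) atTop (𝓝 (J' i j)) := fun i j =>
    tendsto_pi_nhds.1 (tendsto_pi_nhds.1 hJl i) j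
  have hJa : ∀ i j, |J' i j| ≤ a i j := fun i j => abs_le.2 ⟨hJ'.1 i j, hJ'.2 i j⟩
  have hJE := EdgeSpace.of_abs_le ha hJa
  refine ⟨v' - uf, J', fun i hi => sub_eq_zero.2 (hv'.1 i hi), fun i j => ⟨hJa i j, ?_⟩,
    fun i hi => ?_⟩
  · rw [← grad_add, sub_add_cancel]
    refine le_antisymm ((le_abs_self _).trans (by rw [abs_mul]; gcongr; exact hJa i j)) ?_
    by_cases hij : G.Adj i j
    · rw [grad_of_adj hij]
      have hε : Tendsto (fun n => 1 / ((ψ n : ℝ) + 1)) atTop (𝓝 0) :=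
        tendsto_one_div_add_atTop_nhds_zero_nat.comp hψ.tendsto_atTop
      have hd := (hvi i).sub (hvi j)
      have h1 := (hd.abs.sub hε).const_mul (a i j)
      rw [sub_zero] at h1
      exact le_of_tendsto_of_tendsto' h1 ((hJij i j).mul hd) fun n => happ (ψ n) i j
    · rw [ha i j hij, hJE i j hij, zero_mul, zero_mul]
  · exact tendsto_nhds_unique (((continuous_divg i).tendsto J').comp hJl)
      (tendsto_const_nhds.congr fun n => (hdiv (ψ n) i hi).symm)

end Graph

/-! ### Convergence of the iteration. -/

namespace IsSplitBregman

variable {V : Type*} [Fintype V] {G : SimpleGraph V} {B : Set V} {a : V → V → ℝ} {uf : V → ℝ}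
  {α : ℝ} {u : ℕ → V → ℝ} {b d : ℕ → V → V → ℝ}

/-- The update of `b` is exactly the residual of the soft thresholding that produces `d`. Nothing of
this kind holds for the arbitrary initial `b 0` and `d 0`. -/
theorem isAbsSubgradient_succ (h : IsSplitBregman G B a uf α u b d) (ha0 : ∀ i j, 0 ≤ a i j)
    (hα : 0 < α) (k : ℕ) (i j : V) :
    IsAbsSubgradient (a i j / (2 * α)) (b (k + 1) i j) (d (k + 1) i j + grad G uf i j) := by
  have hs := isAbsSubgradient_shrink (div_nonneg (ha0 i j) (by positivity : 0 ≤ 2 * α))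
    (grad G (u (k + 1)) i j + grad G uf i j + b k i j)
  rw [h.b_step, h.d_step, sub_add_cancel]
  convert hs using 1
  ring

theorem mem_edgeSpace (h : IsSplitBregman G B a uf α u b d) (k : ℕ) :
    b k ∈ EdgeSpace G ∧ d k ∈ EdgeSpace G := by
  induction k with
  | zero => exact ⟨h.b_init, h.d_init⟩
  | succ k ih =>
    have hd : d (k + 1) ∈ EdgeSpace G := by
      intro i j hij
      rw [h.d_step, grad_mem_edgeSpace _ i j hij, grad_mem_edgeSpace _ i j hij, ih.1 i j hij]
      simp [shrink]
    refine ⟨fun i j hij => ?_, hd⟩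
    rw [h.b_step, grad_mem_edgeSpace _ i j hij, ih.1 i j hij, hd i j hij]
    simp

theorem antisymm (h : IsSplitBregman G B a uf α u b d) (ha : ∀ i j, a i j = a j i)
    (hb : ∀ i j, b 0 i j = -b 0 j i) (k : ℕ) (i j : V) : b k i j = -b k j i := by
  induction k with
  | zero => exact hb i j
  | succ k ih =>
    have harg : grad G (u (k + 1)) i j + grad G uf i j + b k i j =
        -(grad G (u (k + 1)) j i + grad G uf j i + b k j i) := by
      rw [grad_antisymm _ i j, grad_antisymm uf i j, ih]; ring
    rw [h.b_step, h.b_step, h.d_step, h.d_step, harg, shrink_neg, ha i j, ih,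
      grad_antisymm (u (k + 1)) i j, grad_antisymm uf i j]
    ring

/-- This is the equation for `u` in divergence form; the factor `-2` from `divg_grad` absorbs the `1
/ 2`. -/
theorem divg_residual (h : IsSplitBregman G B a uf α u b d) (k : ℕ) {i : V} (hi : i ∉ B) :
    divg (grad G (u (k + 1)) + b k - d k) i = 0 := by
  have h1 : divg (grad G (u (k + 1)) + b k - d k) i =
      divg (grad G (u (k + 1))) i + divg (b k) i - divg (d k) i := by
    unfold divg
    rw [← Finset.sum_add_distrib, ← Finset.sum_sub_distrib]
    refine Finset.sum_congr rfl fun j _ => ?_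
    simp only [Pi.add_apply, Pi.sub_apply]
    ring
  rw [h1, divg_grad, h.u_interior k i hi]
  ring

/-- The squared distance of the iterate `(b^k, d^k)` from `(c, D w)`. -/
noncomputable def dist (G : SimpleGraph V) (b d : ℕ → V → V → ℝ) (w : V → ℝ) (c : V → V → ℝ)
    (k : ℕ) : ℝ :=
  ∑ i, ∑ j, ((b k i j - c i j) ^ 2 + (d k i j - grad G w i j) ^ 2)

/-- The defect of the iterate `(u^{k+1}, d^{k+1})`. -/
noncomputable def defect (G : SimpleGraph V) (u : ℕ → V → ℝ) (d : ℕ → V → V → ℝ) (k : ℕ) : ℝ :=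
  ∑ i, ∑ j, ((grad G (u (k + 1)) i j - d (k + 1) i j) ^ 2 + (d (k + 1) i j - d k i j) ^ 2)

theorem dist_nonneg (w : V → ℝ) (c : V → V → ℝ) (k : ℕ) : 0 ≤ dist G b d w c k :=
  Finset.sum_nonneg fun _ _ => Finset.sum_nonneg fun _ _ => by positivity

theorem defect_nonneg (k : ℕ) : 0 ≤ defect G u d k :=
  Finset.sum_nonneg fun _ _ => Finset.sum_nonneg fun _ _ => by positivity

/-- The indices start at `k + 1` because the monotonicity inequality between consecutive iterates
needs the subgradient relation at both. -/
theorem dist_add_defect_le (h : IsSplitBregman G B a uf α u b d) (ha : a ∈ EdgeSpace G)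
    (ha0 : ∀ i j, 0 ≤ a i j) (hα : 0 < α) {w : V → ℝ} {c : V → V → ℝ}
    (hs : IsSaddle G B (fun i j => a i j / (2 * α)) uf w c) (k : ℕ) :
    dist G b d w c (k + 2) + defect G u d (k + 1) ≤ dist G b d w c (k + 1) := by
  have hcE : c ∈ EdgeSpace G := EdgeSpace.of_abs_le (a := fun i j => a i j / (2 * α))
    (fun i j hij => by simp [ha i j hij]) fun i j => (hs.subgradient i j).1
  have hrE : grad G (u (k + 2)) + b (k + 1) - d (k + 1) ∈ EdgeSpace G :=
    (EdgeSpace G).sub_mem ((EdgeSpace G).add_mem (grad_mem_edgeSpace _) (h.mem_edgeSpace _).1)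
      (h.mem_edgeSpace _).2
  have hφ : u (k + 2) - w ∈ vanishing B := fun i hi => by
    simp [h.u_boundary (k + 1) i hi, hs.vanish i hi]
  have h1 := edgeInner_grad_eq_zero hrE (fun i hi => h.divg_residual (k + 1) hi) hφ
  have h2 := edgeInner_grad_eq_zero hcE hs.divg_eq_zero hφ
  -- On each edge, right side minus left side is exactly twice the sum of the two monotonicity
  -- products `m1` and `m2`. The cross terms vanish after summation by `h1` and `h2`.
  have hkey : dist G b d w c (k + 2) + defect G u d (k + 1) ≤ dist G b d w c (k + 1)
      + 2 * (edgeInner (grad G (u (k + 2)) + b (k + 1) - d (k + 1)) (grad G (u (k + 2) - w))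
        - edgeInner c (grad G (u (k + 2) - w))) := by
    unfold dist defect edgeInner
    rw [← Finset.sum_sub_distrib, Finset.mul_sum, ← Finset.sum_add_distrib,
      ← Finset.sum_add_distrib]
    refine Finset.sum_le_sum fun i _ => ?_
    rw [← Finset.sum_sub_distrib, Finset.mul_sum, ← Finset.sum_add_distrib,
      ← Finset.sum_add_distrib]
    refine Finset.sum_le_sum fun j _ => ?_
    have m1 := (h.isAbsSubgradient_succ ha0 hα (k + 1) i j).monotone (hs.subgradient i j)
    have m2 := (h.isAbsSubgradient_succ ha0 hα (k + 1) i j).monotone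
      (h.isAbsSubgradient_succ ha0 hα k i j)
    have e := h.b_step (k + 1) i j
    simp only [Pi.add_apply, Pi.sub_apply, grad_sub]
    simp only [show k + 1 + 1 = k + 2 from rfl] at m1 m2 e ⊢
    generalize b (k + 2) i j = b2, b (k + 1) i j = b1, d (k + 2) i j = d2, d (k + 1) i j = d1,
      grad G (u (k + 2)) i j = g, grad G w i j = gw, c i j = c0, grad G uf i j = x at *
    subst e
    nlinarith
  rw [h1, h2] at hkey
  linarith

theorem term_le_double_sum {F : V → V → ℝ} (hF : ∀ i j, 0 ≤ F i j) (i j : V) :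
    F i j ≤ ∑ i, ∑ j, F i j :=
  (Finset.single_le_sum (f := fun j => F i j) (fun j _ => hF i j) (Finset.mem_univ j)).trans
    (Finset.single_le_sum (f := fun i => ∑ j, F i j)
      (fun i _ => Finset.sum_nonneg fun j _ => hF i j) (Finset.mem_univ i))

/-- The defect is bounded by successive differences of a convergent monotone sequence. -/
theorem tendsto_defect (h : IsSplitBregman G B a uf α u b d) (ha : a ∈ EdgeSpace G)
    (ha0 : ∀ i j, 0 ≤ a i j) (hα : 0 < α) {w : V → ℝ} {c : V → V → ℝ}
    (hs : IsSaddle G B (fun i j => a i j / (2 * α)) uf w c) :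
    Tendsto (fun k => defect G u d (k + 1)) atTop (𝓝 0) := by
  have hanti : Antitone fun k => dist G b d w c (k + 1) := antitone_nat_of_succ_le fun k => by
    have := h.dist_add_defect_le ha ha0 hα hs k
    have := defect_nonneg (G := G) (u := u) (d := d) (k + 1)
    show dist G b d w c (k + 2) ≤ _
    linarith
  have hlim := tendsto_atTop_ciInf hanti ⟨0, by rintro _ ⟨k, rfl⟩; exact dist_nonneg _ _ _⟩
  have hdiff := hlim.sub (hlim.comp (tendsto_add_atTop_nat 1))
  rw [sub_self] at hdiff
  refine squeeze_zero (fun k => defect_nonneg _) (fun k => ?_) hdiff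
  have := h.dist_add_defect_le ha ha0 hα hs k
  show _ ≤ dist G b d w c (k + 1) - dist G b d w c (k + 2)
  linarith

theorem tendsto_zero_of_sq_le {ι : Type*} {l : Filter ι} {F : ι → ℝ} {x : ι → ℝ}
    (hF : Tendsto F l (𝓝 0)) (hx : ∀ k, x k ^ 2 ≤ F k) : Tendsto x l (𝓝 0) := by
  have h1 := squeeze_zero (fun k => sq_nonneg (x k)) hx hF
  have h2 := h1.sqrt
  simp only [Real.sqrt_sq_eq_abs, Real.sqrt_zero] at h2
  exact (tendsto_zero_iff_abs_tendsto_zero _).2 h2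

theorem exists_subseq_tendsto (h : IsSplitBregman G B a uf α u b d) (ha : a ∈ EdgeSpace G)
    (ha0 : ∀ i j, 0 ≤ a i j) (hα : 0 < α) {w : V → ℝ} {c : V → V → ℝ}
    (hs : IsSaddle G B (fun i j => a i j / (2 * α)) uf w c) :
    ∃ (b' d' : V → V → ℝ) (ψ : ℕ → ℕ), StrictMono ψ ∧
      Tendsto (fun n => b (ψ n + 1)) atTop (𝓝 b') ∧
      Tendsto (fun n => d (ψ n + 1)) atTop (𝓝 d') := by
  have hbd : ∀ k, dist G b d w c (k + 1) ≤ dist G b d w c 1 := by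
    intro k
    induction k with
    | zero => exact le_rfl
    | succ k ih =>
      have := h.dist_add_defect_le ha ha0 hα hs k
      have := defect_nonneg (G := G) (u := u) (d := d) (k + 1)
      show dist G b d w c (k + 2) ≤ _
      linarith
  set R := √(dist G b d w c 1)
  have hterm : ∀ k i j, |b (k + 1) i j - c i j| ≤ R ∧ |d (k + 1) i j - grad G w i j| ≤ R := by
    intro k i j
    have h1 : _ ≤ dist G b d w c (k + 1) := term_le_double_sum
      (F := fun i j => (b (k + 1) i j - c i j) ^ 2 + (d (k + 1) i j - grad G w i j) ^ 2)
      (fun i j => by positivity) i j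
    have h2 := h1.trans (hbd k)
    exact ⟨Real.abs_le_sqrt (by nlinarith [sq_nonneg (d (k + 1) i j - grad G w i j)]),
      Real.abs_le_sqrt (by nlinarith [sq_nonneg (b (k + 1) i j - c i j)])⟩
  obtain ⟨⟨b', d'⟩, -, ψ, hψ, hlim⟩ :=
    ((isCompact_Icc (a := fun i j => c i j - R) (b := fun i j => c i j + R)).prod
      (isCompact_Icc (a := fun i j => grad G w i j - R)
        (b := fun i j => grad G w i j + R))).tendsto_subseq
      (x := fun n => (b (n + 1), d (n + 1))) fun n =>
      ⟨⟨fun i j => by have := abs_le.1 (hterm n i j).1; show _ - _ ≤ _; linarith,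
        fun i j => by have := abs_le.1 (hterm n i j).1; show _ ≤ _ + _; linarith⟩,
       ⟨fun i j => by have := abs_le.1 (hterm n i j).2; show _ - _ ≤ _; linarith,
        fun i j => by have := abs_le.1 (hterm n i j).2; show _ ≤ _ + _; linarith⟩⟩
  exact ⟨b', d', ψ, hψ, (continuous_fst.tendsto _).comp hlim,
    (continuous_snd.tendsto _).comp hlim⟩

/-- Some saddle point is a cluster point of the iteration. -/
theorem exists_isSaddle_cluster (h : IsSplitBregman G B a uf α u b d) (hG : G.Connected)
    (hB : B.Nonempty) (ha : a ∈ EdgeSpace G) (ha0 : ∀ i j, 0 ≤ a i j) (hα : 0 < α) :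
    ∃ (w : V → ℝ) (c : V → V → ℝ) (ψ : ℕ → ℕ),
      IsSaddle G B (fun i j => a i j / (2 * α)) uf w c ∧ StrictMono ψ ∧
      Tendsto (fun n => b (ψ n + 1)) atTop (𝓝 c) ∧
      Tendsto (fun n => d (ψ n + 1)) atTop (𝓝 (grad G w)) := by
  obtain ⟨w₀, J₀, hs₀⟩ := exists_isSaddle (B := B) ha ha0 uf
  have hs : IsSaddle G B (fun i j => a i j / (2 * α)) uf w₀ ((2 * α)⁻¹ • J₀) := by
    convert hs₀.smul (by positivity : 0 ≤ (2 * α)⁻¹) using 1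
    ext i j
    simp [div_eq_inv_mul]
  obtain ⟨b', d', ψ, hψ, hb, hd⟩ := h.exists_subseq_tendsto ha ha0 hα hs
  have hdef := (h.tendsto_defect ha ha0 hα hs).comp hψ.tendsto_atTop
  have hterm : ∀ i j k, (grad G (u (k + 2)) i j - d (k + 2) i j) ^ 2 +
      (d (k + 2) i j - d (k + 1) i j) ^ 2 ≤ defect G u d (k + 1) := fun i j k =>
    term_le_double_sum (F := fun i j => (grad G (u (k + 2)) i j - d (k + 2) i j) ^ 2 +
      (d (k + 2) i j - d (k + 1) i j) ^ 2) (fun i j => by positivity) i j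
  -- Both halves of the defect are needed: they link the new gradient to the old `d`, the pair
  -- occurring in `divg_residual`. Thus the limit of `d` is a gradient and the limit of `b` has zero
  -- interior divergence.
  have hgd : Tendsto (fun n => grad G (u (ψ n + 2)) - d (ψ n + 1)) atTop (𝓝 0) := by
    refine tendsto_pi_nhds.2 fun i => tendsto_pi_nhds.2 fun j => ?_
    have h1 : Tendsto (fun n => grad G (u (ψ n + 2)) i j - d (ψ n + 2) i j) atTop (𝓝 0) :=
      tendsto_zero_of_sq_le hdef fun n =>
        (le_add_of_nonneg_right (sq_nonneg _)).trans (hterm i j (ψ n))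
    have h2 : Tendsto (fun n => d (ψ n + 2) i j - d (ψ n + 1) i j) atTop (𝓝 0) :=
      tendsto_zero_of_sq_le hdef fun n =>
        (le_add_of_nonneg_left (sq_nonneg _)).trans (hterm i j (ψ n))
    have h3 := h1.add h2
    rw [add_zero] at h3
    refine h3.congr fun n => ?_
    simp
  have hg : Tendsto (fun n => grad G (u (ψ n + 2))) atTop (𝓝 d') := by
    have := hgd.add hd
    rw [zero_add] at this
    simpa using this
  obtain ⟨w, hw, -, hwd⟩ := exists_tendsto_of_tendsto_grad hG hB
    (Eventually.of_forall fun n => h.u_boundary (ψ n + 1)) hg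
  refine ⟨w, b', ψ, ⟨hw, fun i j => ?_, fun i hi => ?_⟩, hψ, hb, hwd ▸ hd⟩
  · rw [hwd]
    exact IsAbsSubgradient.of_tendsto
      (Eventually.of_forall fun n => h.isAbsSubgradient_succ ha0 hα (ψ n) i j)
      (tendsto_pi_nhds.1 (tendsto_pi_nhds.1 hb i) j)
      ((tendsto_pi_nhds.1 (tendsto_pi_nhds.1 hd i) j).add_const _)
  · have h1 := hgd.add hb
    rw [zero_add] at h1
    refine tendsto_nhds_unique (((continuous_divg i).tendsto b').comp h1)
      (tendsto_const_nhds.congr fun n => ?_)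
    rw [← h.divg_residual (ψ n + 1) hi]
    show _ = divg (grad G (u (ψ n + 2)) - d (ψ n + 1) + b (ψ n + 1)) i
    rw [sub_add_eq_add_sub]

/-- The iteration converges to a saddle point. -/
theorem exists_tendsto (h : IsSplitBregman G B a uf α u b d) (hG : G.Connected)
    (hB : B.Nonempty) (ha : a ∈ EdgeSpace G) (ha0 : ∀ i j, 0 ≤ a i j) (hα : 0 < α) :
    ∃ (w : V → ℝ) (c : V → V → ℝ), IsSaddle G B (fun i j => a i j / (2 * α)) uf w c ∧
      Tendsto u atTop (𝓝 w) ∧ Tendsto b atTop (𝓝 c) ∧ Tendsto d atTop (𝓝 (grad G w)) := by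
  obtain ⟨w, c, ψ, hs, hψ, hb, hd⟩ := h.exists_isSaddle_cluster hG hB ha ha0 hα
  have hanti : Antitone fun k => dist G b d w c (k + 1) := antitone_nat_of_succ_le fun k => by
    have := h.dist_add_defect_le ha ha0 hα hs k
    have := defect_nonneg (G := G) (u := u) (d := d) (k + 1)
    show dist G b d w c (k + 2) ≤ _
    linarith
  have hlim := tendsto_atTop_ciInf hanti ⟨0, by rintro _ ⟨k, rfl⟩; exact dist_nonneg _ _ _⟩
  have hsub : Tendsto (fun n => dist G b d w c (ψ n + 1)) atTop (𝓝 0) := by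
    have hc : Continuous fun p : (V → V → ℝ) × (V → V → ℝ) =>
        ∑ i, ∑ j, ((p.1 i j - c i j) ^ 2 + (p.2 i j - grad G w i j) ^ 2) := by fun_prop
    have := (hc.tendsto (c, grad G w)).comp (hb.prodMk_nhds hd)
    simpa [dist, Function.comp_def] using this
  have hzero : Tendsto (dist G b d w c) atTop (𝓝 0) := by
    -- The monotone distance has a limit, which the subsequence identifies as zero.
    rw [tendsto_nhds_unique (hlim.comp hψ.tendsto_atTop) hsub] at hlim
    exact (tendsto_add_atTop_iff_nat 1).1 hlim
  have hterm : ∀ i j k, (b k i j - c i j) ^ 2 + (d k i j - grad G w i j) ^ 2 ≤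
      dist G b d w c k := fun i j k => term_le_double_sum
    (F := fun i j => (b k i j - c i j) ^ 2 + (d k i j - grad G w i j) ^ 2)
      (fun i j => by positivity) i j
  have hb' : Tendsto b atTop (𝓝 c) := tendsto_pi_nhds.2 fun i => tendsto_pi_nhds.2 fun j =>
    tendsto_sub_nhds_zero_iff.1 (tendsto_zero_of_sq_le hzero fun k =>
      (le_add_of_nonneg_right (sq_nonneg _)).trans (hterm i j k))
  have hd' : Tendsto d atTop (𝓝 (grad G w)) :=
    tendsto_pi_nhds.2 fun i => tendsto_pi_nhds.2 fun j =>
      tendsto_sub_nhds_zero_iff.1 (tendsto_zero_of_sq_le hzero fun k =>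
        (le_add_of_nonneg_left (sq_nonneg _)).trans (hterm i j k))
  have hg : Tendsto (fun k => grad G (u (k + 1))) atTop (𝓝 (grad G w)) := by
    have h1 := ((hb'.comp (tendsto_add_atTop_nat 1)).sub hb').add
      (hd'.comp (tendsto_add_atTop_nat 1))
    rw [sub_self, zero_add] at h1
    refine h1.congr fun k => ?_
    ext i j
    simp only [Function.comp_apply, Pi.add_apply, Pi.sub_apply]
    rw [h.b_step]
    ring
  obtain ⟨w', hw', hu, hgw⟩ := exists_tendsto_of_tendsto_grad hG hB
    (Eventually.of_forall fun n => h.u_boundary n) hg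
  refine ⟨w', c, ⟨hw', ?_, hs.divg_eq_zero⟩, (tendsto_add_atTop_iff_nat 1).1 hu, hb', ?_⟩
  · rw [hgw]; exact hs.subgradient
  · rwa [hgw]

end IsSplitBregman

/-! ### Induced and measured currents. -/

section Currents

variable {V : Type*} [Fintype V] {G : SimpleGraph V} {B : Set V} {f : B → ℝ} {a : V → V → ℝ}
  {uf u : V → ℝ} {J : V → V → ℝ}

theorem IsSaddle.subgradient_sub (h : IsSaddle G B a uf u J) (ha : a ∈ EdgeSpace G) (i j : V) :
    IsAbsSubgradient (a i j) (J i j) ((u + uf) i - (u + uf) j) := by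
  by_cases hij : G.Adj i j
  · have := h.subgradient i j
    rwa [← grad_add, grad_of_adj hij] at this
  · have h1 := (h.subgradient i j).1
    rw [ha i j hij] at h1 ⊢
    exact ⟨h1, by rw [abs_nonpos_iff.1 h1, zero_mul, zero_mul]⟩

/-- The antisymmetric part of the current of a saddle point is induced by its voltage. -/
theorem IsSaddle.isInducedCurrent (h : IsSaddle G B a uf u J) (ha : a ∈ EdgeSpace G)
    (ha0 : ∀ i j, 0 ≤ a i j) (hsymm : ∀ i j, a i j = a j i) (huf : ∀ i : B, uf i = f i) :
    ∃ σ, IsInducedCurrent G B f a (u + uf) σ (fun i j => (J i j - J j i) / 2) := by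
  classical
  set v := u + uf with hv
  have hsub := h.subgradient_sub ha
  -- Across a voltage drop, `J i j` and `-J j i` are both the unique subgradient, so
  -- antisymmetrization changes `J` only between vertices of equal voltage.
  have hneg : ∀ i j, v i ≠ v j → J j i = -J i j := fun i j hij => by
    have h1 := (hsub j i).neg
    rw [neg_sub, ← hsymm i j] at h1
    rw [← h1.unique (hsub i j) (sub_ne_zero.2 hij), neg_neg]
  have hle : ∀ i j, |(J i j - J j i) / 2| ≤ a i j := fun i j => by
    have h1 := abs_le.1 (hsub i j).1
    have h2 := abs_le.1 (hsub j i).1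
    rw [← hsymm i j] at h2
    rw [abs_le]
    constructor <;> linarith
  refine ⟨fun i j => if v i = v j then ⊤ else ENNReal.ofReal (a i j / |v i - v j|), ?_⟩
  refine ⟨fun i => ?_, fun i j => ?_, fun i j hij => ?_, fun i j hij => ?_, fun i j hij => ?_,
    fun i j hij _ => ?_, EdgeSpace.of_abs_le ha hle, fun i j => ?_, hle, fun i hi => ?_⟩
  · simp [hv, h.vanish i i.2, huf i]
  · simp only [eq_comm (a := v i), hsymm i j, abs_sub_comm (v i)]
  · simp [hij]
  · have hd : v i - v j ≠ 0 := sub_ne_zero.2 hij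
    rw [if_neg hij, ENNReal.toReal_ofReal (div_nonneg (ha0 i j) (abs_nonneg _)), hneg i j hij]
    refine mul_right_cancel₀ hd ?_
    have h1 := (hsub i j).2
    have h2 : |v i - v j| ≠ 0 := abs_ne_zero.2 hd
    rw [mul_assoc, ← abs_mul_abs_self (v i - v j), ← mul_assoc, div_mul_cancel₀ _ h2, ← h1]
    ring
  · rw [hneg i j hij, ← (hsub i j).abs_eq (sub_ne_zero.2 hij)]
    congr 1
    ring
  · simp [hij]
  · ring
  · have h1 := h.divg_eq_zero i hi
    unfold divg at h1
    rw [← Finset.sum_div, ← neg_eq_zero, ← neg_div, ← Finset.sum_neg_distrib]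
    simp only [neg_sub]
    rw [h1, zero_div]

/-- A measured current and its voltage form a saddle point. -/
theorem IsMeasuredCurrent.isSaddle {v₀ : V → ℝ} {σ₀ J₀ : V → V → ℝ}
    (h : IsMeasuredCurrent B f a v₀ σ₀ J₀) (ha : a ∈ EdgeSpace G) (huf : ∀ i : B, uf i = f i) :
    IsSaddle G B a uf (v₀ - uf) J₀ where
  vanish i hi := by simp [h.boundary ⟨i, hi⟩, huf ⟨i, hi⟩]
  subgradient i j := by
    refine ⟨(h.magnitude i j).le, ?_⟩
    rw [← grad_add, sub_add_cancel, ← h.magnitude i j, ← abs_mul, eq_comm, abs_eq_self]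
    rw [EdgeSpace.mul_grad (EdgeSpace.of_abs_le ha fun i j => (h.magnitude i j).le), h.ohm,
      mul_assoc]
    exact mul_nonneg (h.nonneg i j) (mul_self_nonneg _)
  divg_eq_zero i hi := by
    have h1 : ∀ j, J₀ j i = -J₀ i j := fun j => by
      rw [h.ohm, h.ohm, h.symm j i]; ring
    unfold divg
    simp only [h1]
    rw [Finset.sum_sub_distrib, Finset.sum_neg_distrib, h.kirchhoff i hi]
    simp

/-- The current of a saddle point is the measured one, if the conductivities are finite. -/
theorem IsSaddle.eq_of_isMeasuredCurrent (hs : IsSaddle G B a uf u J) (ha : a ∈ EdgeSpace G)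
    (huf : ∀ i : B, uf i = f i) {v₀ : V → ℝ} {σ₀ J₀ : V → V → ℝ}
    (h : IsMeasuredCurrent B f a v₀ σ₀ J₀) : J = J₀ := by
  have hs₀ := h.isSaddle (G := G) ha huf
  ext i j
  by_cases haij : a i j = 0
  · have h1 := (hs.subgradient i j).1
    have h2 := (hs₀.subgradient i j).1
    rw [haij] at h1 h2
    rw [abs_nonpos_iff.1 h1, abs_nonpos_iff.1 h2]
  -- Saddle points are interchangeable: `J` is also a subgradient at the measured voltage drop,
  -- which is nonzero since `a i j ≠ 0` and the conductivity is finite.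
  · refine (hs.subgradient_of_isSaddle ha hs₀ i j).unique (hs₀.subgradient i j) ?_
    have hadj : G.Adj i j := by
      by_contra hij
      exact haij (ha i j hij)
    rw [← grad_add, sub_add_cancel, grad_of_adj hadj]
    intro h0
    apply haij
    rw [← h.magnitude, h.ohm, h0, mul_zero, abs_zero]

end Currents

end Network

theorem mainTheorem9 {V : Type*} [Fintype V] (G : SimpleGraph V) (hG : G.Connected)
    (B : Set V) (hB : B.Nonempty) (f : B → ℝ)
    (a : V → V → ℝ) (ha : a ∈ Network.EdgeSpace G) (ha0 : ∀ i j, 0 ≤ a i j)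
    (uf : V → ℝ) (huf : ∀ i : B, uf i = f i) (α : ℝ) (hα : 0 < α)
    (u : ℕ → V → ℝ) (b d : ℕ → V → V → ℝ)
    (hrun : Network.IsSplitBregman G B a uf α u b d) :
    ∃ (u' : V → ℝ) (J : V → V → ℝ),
      Filter.Tendsto u Filter.atTop (nhds u') ∧
      Filter.Tendsto b Filter.atTop (nhds ((1 / (2 * α)) • J)) ∧
      Filter.Tendsto d Filter.atTop (nhds (Network.grad G u')) ∧
      Network.IsPrimalSolution G B a uf u' ∧
      Network.IsDualSolution G B a uf ((-(1 / 2) : ℝ) • J) ∧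
      -- `J` flows down the potential `u' + uf`, with magnitude `a` wherever the potential drops
      (∀ i j, 0 ≤ J i j * ((u' + uf) i - (u' + uf) j)) ∧
      (∀ i j, (u' + uf) i ≠ (u' + uf) j → |J i j| = a i j) ∧
      -- for symmetric `a`, `u' + uf` is a voltage potential, induced by the net current of `J`
      ((∀ i j, a i j = a j i) →
        Network.IsVoltagePotential G B f a (u' + uf) ∧
        (∃ σ, Network.IsInducedCurrent G B f a (u' + uf) σ (fun i j => (J i j - J j i) / 2)) ∧
        ((∀ i j, b 0 i j = -b 0 j i) → (∀ i j, d 0 i j = -d 0 j i) →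
          ∃ σ, Network.IsInducedCurrent G B f a (u' + uf) σ J)) ∧
      -- if `a` is measured on a network of finite conductivities, `J` is the measured current
      (∀ v₀ σ₀ J₀, Network.IsMeasuredCurrent B f a v₀ σ₀ J₀ →
        J = J₀ ∧ ∀ i j, |J i j| = a i j) := by
  obtain ⟨w, c, hs, hu, hb, hd⟩ := hrun.exists_tendsto hG hB ha ha0 hα
  have h2α : (2 * α) ≠ 0 := by positivity
  -- Multiplying by `2 * α` turns the weights `a / (2 * α)` of the iteration into `a`, with the same
  -- potential.
  have hsJ : Network.IsSaddle G B a uf w ((2 * α) • c) := by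
    convert hs.smul (by positivity : 0 ≤ 2 * α) using 1
    ext i j
    simp only [Pi.smul_apply, smul_eq_mul]
    field_simp
  refine ⟨w, (2 * α) • c, hu, ?_, hd, hsJ.isPrimalSolution ha, hsJ.isDualSolution ha,
    fun i j => (hsJ.subgradient_sub ha i j).mul_nonneg,
    fun i j hij => (hsJ.subgradient_sub ha i j).abs_eq (sub_ne_zero.2 hij),
    fun hsymm => ?_, fun v₀ σ₀ J₀ h₀ => ?_⟩
  · rwa [smul_smul, one_div, inv_mul_cancel₀ h2α, one_smul]
  · obtain ⟨σ, hσ⟩ := hsJ.isInducedCurrent ha ha0 hsymm huf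
    refine ⟨⟨σ, _, hσ⟩, ⟨σ, hσ⟩, fun hb0 _ => ⟨σ, ?_⟩⟩
    have hc : ∀ i j, c i j = -c j i := fun i j =>
      tendsto_nhds_unique (tendsto_pi_nhds.1 (tendsto_pi_nhds.1 hb i) j)
        ((tendsto_pi_nhds.1 (tendsto_pi_nhds.1 hb j) i).neg.congr fun k =>
          (hrun.antisymm hsymm hb0 k i j).symm)
    convert hσ using 1
    ext i j
    simp only [Pi.smul_apply, smul_eq_mul, hc j i]
    ring
  · have hJ := hsJ.eq_of_isMeasuredCurrent ha huf h₀
    exact ⟨hJ, fun i j => by rw [hJ, h₀.magnitude]⟩
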